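/- Let $\mathcal M\subseteq B(H)$ be a von Neumann algebra on a complex Hilbert space $H$, and let $T:\mathcal M\to\mathcal M$ be a normal completely positive linear map which is subunital, i.e. $T(1)\le 1$. Put $d(T):=1-T(1)\ge 0$, let $$n_T:=\min\{n\ge 1:\ T^n(d(T))=0\}$$ be the stabilization index ($n_T=\infty$ if there is no such $n$), and let $$Q:=\bigvee_{k\ge 0}\operatorname{supp}\bigl(T^k(d(T))\bigr)\in\mathcal M$$ be the orbit-support projection, where $\operatorname{supp}(a)$ is the orthogonal projection onto the closure of the range of $a$. Assume that $n_T<\infty$, that $Q$ is a finite projection, and that $Q\mathcal MQ\cong M_s(\mathbb C)$ as $*$-algebras for some integer $s\ge 1$. Then $$n_T\le s.$$ Moreover, the corner map $\alpha:Q\mathcal MQ\to Q\mathcal MQ$, $\alpha(x)=Q\,T(x)\,Q$, on $Q\mathcal MQ\cong M_s(\mathbb C)$ is completely positive and nilpotent, with $\alpha^s=0$. -/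

import Mathlib

open scoped CStarAlgebra

/-! ### C⋆-subalgebras carry the order of the ambient algebra -/

/-- In a norm-closed ⋆-subalgebra of a C⋆-algebra the order inherited from the ambient algebra is
the intrinsic one: an element is nonnegative iff it is `star y * y` for some `y` of the
subalgebra. -/
theorem starOrderedRing_of_isClosed {S A : Type*} [NonUnitalCStarAlgebra A] [PartialOrder A]
    [StarOrderedRing A] [SetLike S A] [NonUnitalSubringClass S A] [SMulMemClass S ℂ A]
    [StarMemClass S A] (s : S) (hs : IsClosed (s : Set A)) : StarOrderedRing s := by
  refine StarOrderedRing.of_nonneg_iff' (fun {x y} h z => ?_) (fun x => ⟨fun hx => ?_, ?_⟩)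
  · exact add_le_add_right (α := A) h (z : A)
  · have hx' : (0 : A) ≤ (x : A) := hx
    let B : NonUnitalStarSubalgebra ℂ A :=
      { carrier := s
        add_mem' := fun ha hb => add_mem ha hb
        zero_mem' := zero_mem s
        mul_mem' := fun ha hb => mul_mem ha hb
        smul_mem' := fun c _ hb => SMulMemClass.smul_mem c hb
        star_mem' := fun ha => star_mem ha }
    have hsq : CFC.sqrt (x : A) ∈ NonUnitalStarAlgebra.elemental ℂ (x : A) := by
      rw [CFC.sqrt_eq_real_sqrt (x : A) hx', cfcₙ_real_eq_complex]
      exact cfcₙ_mem_elemental _ _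
    have hle : NonUnitalStarAlgebra.elemental ℂ (x : A) ≤ B :=
      NonUnitalStarSubalgebra.topologicalClosure_minimal _
        (NonUnitalStarAlgebra.adjoin_le (Set.singleton_subset_iff.mpr x.2)) hs
    refine ⟨⟨CFC.sqrt (x : A), hle hsq⟩, Subtype.ext ?_⟩
    have h1 : star (CFC.sqrt (x : A)) = CFC.sqrt (x : A) :=
      (IsSelfAdjoint.of_nonneg (CFC.sqrt_nonneg (x : A))).star_eq
    change (x : A) = star (CFC.sqrt (x : A)) * CFC.sqrt (x : A)
    rw [h1, CFC.sqrt_mul_sqrt_self (x : A) hx']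
  · rintro ⟨y, rfl⟩
    exact star_mul_self_nonneg (y : A)

/-! ### The C⋆-algebra structure of a von Neumann algebra -/

namespace VonNeumannAlgebra

variable {H : Type*} [NormedAddCommGroup H] [InnerProductSpace ℂ H] [CompleteSpace H]

instance instSMulMemClassComplex : SMulMemClass (VonNeumannAlgebra H) ℂ (H →L[ℂ] H) where
  smul_mem {S} c _ hx := S.toStarSubalgebra.smul_mem hx c

instance instIsClosed (M : VonNeumannAlgebra H) : IsClosed (M : Set (H →L[ℂ] H)) := by
  rw [← M.centralizer_centralizer]
  exact Set.isClosed_centralizer _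

instance instStarOrderedRing (M : VonNeumannAlgebra H) : StarOrderedRing M :=
  starOrderedRing_of_isClosed M M.instIsClosed

end VonNeumannAlgebra

/-! ### Corners -/

/-- The corner `Q A Q` of a C⋆-algebra at a projection `Q`. -/
def cornerAlgebra {A : Type*} [CStarAlgebra A] (Q : A) (hQ : IsStarProjection Q) :
    NonUnitalStarSubalgebra ℂ A where
  carrier := {x | ∃ y, x = Q * y * Q}
  add_mem' := by
    rintro _ _ ⟨a, rfl⟩ ⟨b, rfl⟩
    exact ⟨a + b, by rw [mul_add, add_mul]⟩
  zero_mem' := ⟨0, by simp⟩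
  mul_mem' := by
    rintro _ _ ⟨a, rfl⟩ ⟨b, rfl⟩
    exact ⟨a * Q * Q * b, by simp only [mul_assoc]⟩
  smul_mem' := by
    rintro c _ ⟨a, rfl⟩
    exact ⟨c • a, by simp⟩
  star_mem' := by
    rintro _ ⟨a, rfl⟩
    exact ⟨star a, by simp [hQ.isSelfAdjoint.star_eq, mul_assoc]⟩

section Corner

variable {A : Type*} [CStarAlgebra A] {Q : A} (hQ : IsStarProjection Q)

theorem mem_cornerAlgebra_iff {x : A} : x ∈ cornerAlgebra Q hQ ↔ Q * x * Q = x := by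
  refine ⟨?_, fun h => ⟨x, h.symm⟩⟩
  rintro ⟨y, rfl⟩
  have h : Q * Q = Q := hQ.isIdempotentElem
  calc Q * (Q * y * Q) * Q = (Q * Q) * y * (Q * Q) := by simp only [mul_assoc]
    _ = Q * y * Q := by rw [h]

instance cornerAlgebra.instIsClosed : IsClosed (cornerAlgebra Q hQ : Set A) := by
  have h : (cornerAlgebra Q hQ : Set A) = {x | Q * x * Q = x} :=
    Set.ext fun x => mem_cornerAlgebra_iff hQ
  rw [h]
  exact isClosed_eq (by fun_prop) continuous_id

instance cornerAlgebra.instStarOrderedRing [PartialOrder A] [StarOrderedRing A] :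
    StarOrderedRing (cornerAlgebra Q hQ) :=
  starOrderedRing_of_isClosed _ (cornerAlgebra.instIsClosed hQ)

/-- The compression `x ↦ Q T(x) Q` of a linear map `T` to the corner at `Q`. -/
noncomputable def cornerMap (T : A →ₗ[ℂ] A) : Module.End ℂ (cornerAlgebra Q hQ) where
  toFun x := ⟨Q * T x * Q, T x, rfl⟩
  map_add' x y := Subtype.ext (by simp [mul_add, add_mul])
  map_smul' c x := Subtype.ext (by simp)

end Corner

/-! ### Classes of maps and projections -/

/-- A linear map between C⋆-algebras is completely positive if all its amplifications to square
matrices are positive. -/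
def IsCompletelyPositive {A B : Type*} [NonUnitalCStarAlgebra A] [NonUnitalCStarAlgebra B]
    [PartialOrder A] [PartialOrder B] [StarOrderedRing A] [StarOrderedRing B]
    (f : A →ₗ[ℂ] B) : Prop :=
  ∃ φ : A →CP B, φ.toLinearMap = f

/-- A map is normal if it preserves the suprema of bounded increasing nets of self-adjoint
elements (the nets being given as directed sets having a supremum). -/
def IsNormalMap {A B : Type*} [Star A] [PartialOrder A] [PartialOrder B] (f : A → B) : Prop :=
  ∀ D : Set A, D.Nonempty → (∀ x ∈ D, IsSelfAdjoint x) → DirectedOn (· ≤ ·) D →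
    ∀ a : A, IsLUB D a → IsLUB (f '' D) (f a)

/-- A projection is (Murray–von Neumann) finite if it is not equivalent to a proper
subprojection of itself. -/
def IsFiniteProjection {A : Type*} [Mul A] [Star A] [LE A] (Q : A) : Prop :=
  IsStarProjection Q ∧ ∀ v : A, star v * v = Q → v * star v ≤ Q → v * star v = Q

/-! ### Defect and stabilization index -/

/-- The defect `d(T) = 1 - T(1)`. -/
def defect {A : Type*} [Ring A] [Module ℂ A] (T : A →ₗ[ℂ] A) : A := 1 - T 1

/-- The defect orbit `T^k(d(T))`. -/
def defectOrbit {A : Type*} [Ring A] [Module ℂ A] (T : A →ₗ[ℂ] A) (k : ℕ) : A :=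
  (T ^ k : Module.End ℂ A) (defect T)

/-- The stabilization index: the least `n ≥ 1` with `T^n(d(T)) = 0`, and `⊤` if there is none. -/
noncomputable def stabilizationIndex {A : Type*} [Ring A] [Module ℂ A] (T : A →ₗ[ℂ] A) : ℕ∞ :=
  ⨅ (n : ℕ) (_ : 1 ≤ n ∧ defectOrbit T n = 0), (n : ℕ∞)

/-! ### Support projections -/

namespace VonNeumannAlgebra

variable {H : Type*} [NormedAddCommGroup H] [InnerProductSpace ℂ H] [CompleteSpace H]

/-- The orthogonal projection onto the closure of a subspace `K` that is invariant under the
commutant of a von Neumann algebra, as an element of that algebra. -/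
noncomputable def closureProj (M : VonNeumannAlgebra H) (K : Submodule ℂ H)
    (hK : ∀ y ∈ M.commutant, ∀ v ∈ K, y v ∈ K) : M :=
  ⟨K.topologicalClosure.starProjection, by
    rw [IsStarProjection.mem_iff isStarProjection_starProjection]
    intro y hy
    rw [Submodule.range_starProjection, Module.End.mem_invtSubmodule]
    intro v hv
    exact map_mem_closure y.continuous hv (hK y hy)⟩

theorem isStarProjection_closureProj (M : VonNeumannAlgebra H) (K : Submodule ℂ H)
    (hK : ∀ y ∈ M.commutant, ∀ v ∈ K, y v ∈ K) : IsStarProjection (M.closureProj K hK) :=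
  have h : IsStarProjection K.topologicalClosure.starProjection :=
    isStarProjection_starProjection
  ⟨Subtype.ext h.isIdempotentElem, Subtype.ext h.isSelfAdjoint⟩

theorem range_invariant (M : VonNeumannAlgebra H) (a : M) :
    ∀ y ∈ M.commutant, ∀ v ∈ (a : H →L[ℂ] H).range, y v ∈ (a : H →L[ℂ] H).range := by
  rintro y hy _ ⟨w, rfl⟩
  refine ⟨y w, ?_⟩
  exact congrArg (fun f : H →L[ℂ] H => f w) (mem_commutant_iff.mp hy a a.2)

/-- The support projection of `a`: the projection onto the closure of its range. -/
noncomputable def supportProj (M : VonNeumannAlgebra H) (a : M) : M :=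
  M.closureProj (a : H →L[ℂ] H).range (M.range_invariant a)

theorem iSup_range_invariant (M : VonNeumannAlgebra H) {ι : Type*} (p : ι → M) :
    ∀ y ∈ M.commutant, ∀ v ∈ ⨆ i, (p i : H →L[ℂ] H).range,
      y v ∈ ⨆ i, (p i : H →L[ℂ] H).range := by
  intro y hy
  suffices h : (⨆ i, (p i : H →L[ℂ] H).range) ≤
      (⨆ i, (p i : H →L[ℂ] H).range).comap (y : H →ₗ[ℂ] H) from fun v hv => h hv
  refine iSup_le fun i v hv => ?_
  exact Submodule.mem_iSup_of_mem i (M.range_invariant (p i) y hy v hv)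

/-- The supremum `⋁ i, p i` of a family of projections: the projection onto the closed linear
span of their ranges. -/
noncomputable def projSup (M : VonNeumannAlgebra H) {ι : Type*} (p : ι → M) : M :=
  M.closureProj (⨆ i, (p i : H →L[ℂ] H).range) (M.iSup_range_invariant p)

/-- The orbit-support projection `⋁ k, supp (T^k(d(T)))`. -/
noncomputable def orbitSupport (M : VonNeumannAlgebra H) (T : M →ₗ[ℂ] M) : M :=
  M.projSup fun k : ℕ => M.supportProj (defectOrbit T k)

theorem isStarProjection_orbitSupport (M : VonNeumannAlgebra H) (T : M →ₗ[ℂ] M) :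
    IsStarProjection (M.orbitSupport T) :=
  M.isStarProjection_closureProj _ (M.iSup_range_invariant _)

end VonNeumannAlgebra

/-! The defect orbit `T^k(d(T))` is positive and lies under `Q`, so the corner map `α` shifts it.
Its sum `A` over `k < n` has support `Q`, hence is an injective positive matrix after `Q M Q ≅ M_s`,
and `α^n A = 0`. Since `1 ≤ c A` for some `c`, also `α^n 1 = 0`.

The matrices `X_k = α^k(1)` decrease, so their kernels grow. If two consecutive kernels agree, then
`X_k ≤ c X_{k+1}`; iterating gives `X_k ≤ c^m X_{k+m}`, which vanishes at `m = n`. The kernels thus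
grow strictly until `X_k = 0`, and dimension `s` forces `X_s = 0`. Positivity gives `α^s = 0`, and
applying this to `d(T)` bounds the index. The kernel argument is
`Matrix.pow_eq_zero_of_nilpotent_positive`; the transfer is
`cornerMap_pow_eq_zero_of_defectOrbit_eq_zero`. -/

/-! ### Nilpotent positive maps on matrices. -/

-- With `P` the spectral projection of `B` off zero, `A ≤ ‖A‖ P` and `P ≤ c B`.
open scoped MatrixOrder Matrix.Norms.L2Operator in
theorem Matrix.exists_le_smul_of_ker_le {ι : Type*} [Fintype ι] [DecidableEq ι]
    {A B : Matrix ι ι ℂ} (hA : 0 ≤ A) (hB : 0 ≤ B)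
    (h : ∀ v, B.mulVec v = 0 → A.mulVec v = 0) : ∃ c : ℝ, 0 ≤ c ∧ A ≤ c • B := by
  have hfin : (spectrum ℝ B).Finite := Matrix.finite_real_spectrum
  have hcont (f : ℝ → ℝ) : ContinuousOn f (spectrum ℝ B) := hfin.continuousOn f
  have hBs : IsSelfAdjoint B := .of_nonneg hB
  have hAs : IsSelfAdjoint A := .of_nonneg hA
  have hspec : ∀ x ∈ spectrum ℝ B, 0 ≤ x := fun x hx => spectrum_nonneg_of_nonneg hB hx
  let f : ℝ → ℝ := fun x => if x = 0 then 0 else 1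
  let P := cfc f B
  have hPs : star P = P := (cfc_predicate f B : IsSelfAdjoint P).star_eq
  have hPP : P * P = P := by
    rw [← cfc_mul f f B (hcont _) (hcont _)]
    exact cfc_congr fun x _ => by by_cases hx : x = 0 <;> simp [f, hx]
  have hBP : B * P = B := by
    calc B * P = cfc (fun x : ℝ => x) B * cfc f B := by rw [cfc_id' ℝ B]
      _ = cfc (fun x => x * f x) B := (cfc_mul _ f B (hcont _) (hcont _)).symm
      _ = cfc (fun x : ℝ => x) B := cfc_congr fun x _ => by by_cases hx : x = 0 <;> simp [f, hx]
      _ = B := cfc_id' ℝ B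
  have hAP : A * P = A := by
    rw [← sub_eq_zero]
    refine Matrix.ext_of_mulVec_single fun j => ?_
    have hB0 : B.mulVec ((P - 1).mulVec (Pi.single j 1)) = 0 := by
      rw [Matrix.mulVec_mulVec, mul_sub, hBP, mul_one, sub_self, Matrix.zero_mulVec]
    have hA0 := h _ hB0
    rwa [Matrix.mulVec_mulVec, mul_sub, mul_one, ← Matrix.zero_mulVec (Pi.single j 1)] at hA0
  have hPA : P * A = A := by
    simpa [hPs, hAs.star_eq] using congrArg star hAP
  have hle : A ≤ ‖A‖ • P := by
    have h1 := CStarAlgebra.star_left_conjugate_le_norm_smul (a := P) (b := A) hAs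
    rwa [hPs, hPA, hAP, hPP] at h1
  -- Any bound on the reciprocals of the nonzero eigenvalues would do; a zero eigenvalue contributes
  -- `0⁻¹ = 0`.
  let c : ℝ := ∑ x ∈ hfin.toFinset, x⁻¹
  have hc : ∀ x ∈ spectrum ℝ B, x⁻¹ ≤ c := fun x hx =>
    Finset.single_le_sum (f := fun x : ℝ => x⁻¹)
      (fun y hy => inv_nonneg.2 (hspec y (hfin.mem_toFinset.1 hy))) (hfin.mem_toFinset.2 hx)
  have hc0 : 0 ≤ c :=
    Finset.sum_nonneg fun y hy => inv_nonneg.2 (hspec y (hfin.mem_toFinset.1 hy))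
  have hPB : P ≤ c • B := by
    rw [← cfc_const_mul_id c B]
    refine cfc_mono (fun x hx => ?_) (hcont _) (hcont _)
    by_cases h0 : x = 0
    · simp [f, h0]
    · have hx0 : 0 < x := lt_of_le_of_ne (hspec x hx) (Ne.symm h0)
      simpa [f, h0] using (inv_le_iff_one_le_mul₀ hx0).1 (hc x hx)
  refine ⟨‖A‖ * c, mul_nonneg (norm_nonneg _) hc0, hle.trans ?_⟩
  rw [mul_smul]
  exact smul_le_smul_of_nonneg_left hPB (norm_nonneg _)

open scoped MatrixOrder ComplexOrder Matrix.Norms.L2Operator in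
theorem Matrix.pow_eq_zero_of_nilpotent_positive {s n : ℕ}
    (β : Module.End ℂ (Matrix (Fin s) (Fin s) ℂ)) (hpos : ∀ X, 0 ≤ X → 0 ≤ β X)
    (hone : β 1 ≤ 1) {A : Matrix (Fin s) (Fin s) ℂ} (hA : 0 ≤ A)
    (hreg : ∀ N, A * N = 0 → N = 0) (hn : (β ^ n) A = 0) : β ^ s = 0 := by
  have hpow : ∀ k X, 0 ≤ X → 0 ≤ (β ^ k) X := by
    intro k
    induction k with
    | zero => exact fun X hX => hX
    | succ k ih =>
      intro X hX
      rw [pow_succ', Module.End.mul_apply]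
      exact hpos _ (ih X hX)
  have hmono : ∀ k X Y, X ≤ Y → (β ^ k) X ≤ (β ^ k) Y := fun k X Y hXY => by
    rw [← sub_nonneg, ← map_sub]
    exact hpow k _ (sub_nonneg.2 hXY)
  have hsmul : ∀ k (c : ℝ) X, (β ^ k) (c • X) = c • (β ^ k) X := fun k c X =>
    LinearMap.map_smul_of_tower _ c X
  let X : ℕ → Matrix (Fin s) (Fin s) ℂ := fun k => (β ^ k) 1
  have hX0 : ∀ k, 0 ≤ X k := fun k => hpow k 1 zero_le_one
  have hXadd : ∀ k m, (β ^ k) (X m) = X (k + m) := fun k m => by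
    simp only [X, pow_add, Module.End.mul_apply]
  have hXanti : ∀ k, X (k + 1) ≤ X k := fun k => by
    rw [← hXadd]
    exact hmono k _ _ (by simpa [X] using hone)
  have hXn : X n = 0 := by
    obtain ⟨c, -, hc⟩ := Matrix.exists_le_smul_of_ker_le (zero_le_one (α := Matrix (Fin s) (Fin s) ℂ))
      hA fun v hv => by
        -- The matrix all of whose columns are `v` turns cancellation into injectivity on vectors.
        have hN := hreg (Matrix.of fun i _ => v i) (by
          ext i j
          exact congrFun hv i)
        have hv0 : v = 0 := funext fun i => congrFun (congrFun hN i) i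
        rw [hv0, Matrix.mulVec_zero]
    refine le_antisymm ?_ (hX0 n)
    have h1 := hmono n _ _ hc
    rwa [hsmul, hn, smul_zero] at h1
  -- A kernel that stops growing gives a domination that iterates down to zero.
  have hstep : ∀ k, (∀ v, (X (k + 1)).mulVec v = 0 → (X k).mulVec v = 0) → X k = 0 := by
    intro k hk
    obtain ⟨c, hc0, hc⟩ := Matrix.exists_le_smul_of_ker_le (hX0 k) (hX0 (k + 1)) hk
    have hiter : ∀ m, X k ≤ c ^ m • X (m + k) := by
      intro m
      induction m with
      | zero => simp
      | succ m ih =>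
        refine ih.trans ?_
        have h1 := hmono m _ _ hc
        rw [hsmul, hXadd, hXadd] at h1
        rw [pow_succ, mul_smul, show m + 1 + k = m + (k + 1) by omega]
        exact smul_le_smul_of_nonneg_left h1 (pow_nonneg hc0 m)
    have hz : X (n + k) = 0 := by rw [add_comm, ← hXadd, hXn, map_zero]
    refine le_antisymm ?_ (hX0 k)
    simpa [hz] using hiter n
  let K : ℕ → Submodule ℂ (Fin s → ℂ) := fun k => LinearMap.ker (X k).mulVecLin
  have hKmono : ∀ k, K k ≤ K (k + 1) := by
    intro k v hv
    simp only [K, LinearMap.mem_ker, Matrix.mulVecLin_apply] at hv ⊢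
    -- For `v` in the kernel of `X k`, the form `⟨v, X (k+1) v⟩` is squeezed between `0` and `⟨v, X
    -- k v⟩ = 0`.
    have h1 := (Matrix.le_iff.1 (hXanti k)).dotProduct_mulVec_nonneg v
    rw [Matrix.sub_mulVec, hv, zero_sub, dotProduct_neg] at h1
    have h2 := (Matrix.nonneg_iff_posSemidef.1 (hX0 (k + 1))).dotProduct_mulVec_nonneg v
    exact ((Matrix.nonneg_iff_posSemidef.1 (hX0 (k + 1))).dotProduct_mulVec_zero_iff v).1
      (le_antisymm (neg_nonneg.1 h1) h2)
  have hdim : ∀ k, X k = 0 ∨ k ≤ Module.finrank ℂ (K k) := by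
    intro k
    induction k with
    | zero => exact Or.inr (Nat.zero_le _)
    | succ k ih =>
      by_cases hz : X k = 0
      · left
        exact le_antisymm (hz ▸ hXanti k) (hX0 _)
      · right
        have hlt : K k < K (k + 1) := by
          refine lt_of_le_not_ge (hKmono k) fun hle => hz (hstep k fun v hv => ?_)
          exact hle hv
        exact (ih.resolve_left hz).trans_lt (Submodule.finrank_lt_finrank_of_lt hlt)
  have hXs : X s = 0 := by
    rcases hdim s with h | h
    · exact h
    · have htop : K s = ⊤ := Submodule.eq_top_of_finrank_eq
        (le_antisymm (Submodule.finrank_le _) (by simpa using h))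
      refine Matrix.ext_of_mulVec_single fun j => ?_
      have hm : Pi.single j 1 ∈ K s := htop ▸ Submodule.mem_top
      rw [Matrix.zero_mulVec]
      exact hm
  -- Positive matrices span, and each satisfies `Y ≤ ‖Y‖ • 1`.
  refine LinearMap.ext_on CStarAlgebra.span_nonneg fun Y (hY : 0 ≤ Y) => ?_
  refine le_antisymm ?_ (hpow s Y hY)
  have h1 := hmono s _ _ (IsSelfAdjoint.of_nonneg hY).le_algebraMap_norm_self
  rw [Algebra.algebraMap_eq_smul_one, hsmul] at h1
  change _ ≤ _ • X s at h1
  rwa [hXs, smul_zero] at h1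

/-! ### Complete positivity of the corner map. -/

/-- Compressing `y` by its negative part gives `-(y⁻)³`, whose image is both nonnegative and
nonpositive; hence `(y⁻)³ = 0`, so `y⁻ = 0`. -/
theorem nonneg_of_map_nonneg_of_injective {B C : Type*} [NonUnitalCStarAlgebra B] [PartialOrder B]
    [StarOrderedRing B] [NonUnitalCStarAlgebra C] [PartialOrder C] [StarOrderedRing C]
    (f : B →⋆ₙₐ[ℂ] C) (hf : Function.Injective f) {y : B} (hy : 0 ≤ f y) : 0 ≤ y := by
  have hys : IsSelfAdjoint y := hf (by rw [map_star, (IsSelfAdjoint.of_nonneg hy).star_eq])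
  have hm : 0 ≤ y⁻ := CFC.negPart_nonneg y
  have hms : star y⁻ = y⁻ := (IsSelfAdjoint.of_nonneg hm).star_eq
  have hmul : y⁻ * y * y⁻ = -(y⁻ * y⁻ * y⁻) := by
    have h := congrArg (fun z => y⁻ * z * y⁻) (CFC.posPart_sub_negPart y hys)
    rw [← h]
    simp only [mul_sub, CFC.negPart_mul_posPart, zero_sub, neg_mul]
  have h1 : 0 ≤ y⁻ * y⁻ * y⁻ := by
    simpa [hms] using star_left_conjugate_nonneg hm y⁻
  have h2 : 0 ≤ f (-(y⁻ * y⁻ * y⁻)) := by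
    rw [← hmul, map_mul, map_mul]
    simpa [← map_star, hms] using star_left_conjugate_nonneg hy (f y⁻)
  have h3 : y⁻ * y⁻ * y⁻ = 0 := by
    apply hf
    rw [map_zero]
    refine le_antisymm ?_ (map_nonneg f h1)
    rwa [map_neg, neg_nonneg] at h2
  have h4 : y⁻ * y⁻ = 0 := by
    rw [← CStarRing.star_mul_self_eq_zero_iff, star_mul, hms, ← mul_assoc, h3, zero_mul]
  have h5 : y⁻ = 0 := by
    rw [← CStarRing.star_mul_self_eq_zero_iff, hms, h4]
  exact (CFC.negPart_eq_zero_iff y hys).1 h5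

/-- Viewed in matrices over `A`, the amplified corner map is the amplification of `T` conjugated by
`diag(Q, …, Q)`. Positivity is then reflected back to matrices over the corner. -/
theorem isCompletelyPositive_cornerMap {A : Type*} [CStarAlgebra A] [PartialOrder A]
    [StarOrderedRing A] {Q : A} (hQ : IsStarProjection Q) {T : A →ₗ[ℂ] A}
    (hT : IsCompletelyPositive T) : IsCompletelyPositive (cornerMap hQ T) := by
  obtain ⟨φ, rfl⟩ := hT
  refine ⟨⟨cornerMap hQ φ.toLinearMap, fun k N hN => ?_⟩, rfl⟩
  let ι : cornerAlgebra Q hQ →⋆ₙₐ[ℂ] A := NonUnitalStarSubalgebraClass.subtype (cornerAlgebra Q hQ)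
  let Φ : CStarMatrix (Fin k) (Fin k) (cornerAlgebra Q hQ) →⋆ₙₐ[ℂ] CStarMatrix (Fin k) (Fin k) A :=
    CStarMatrix.mapₙₐ ι
  have hΦ : Function.Injective Φ := CStarMatrix.map_injective Subtype.val_injective
  refine nonneg_of_map_nonneg_of_injective Φ hΦ ?_
  have h1 : 0 ≤ (Φ N).map φ := φ.map_cstarMatrix_nonneg _ (map_nonneg Φ hN)
  let D : CStarMatrix (Fin k) (Fin k) A := CStarMatrix.ofMatrix (Matrix.diagonal fun _ => Q)
  have hD : star D = D := by
    ext i j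
    rw [CStarMatrix.star_apply]
    by_cases hij : i = j
    · subst hij
      simp [D, hQ.isSelfAdjoint.star_eq]
    · simp [D, Matrix.diagonal_apply_ne _ hij, Matrix.diagonal_apply_ne _ (Ne.symm hij)]
  have h2 : Φ (N.map (cornerMap hQ φ.toLinearMap)) = star D * (Φ N).map φ * D := by
    rw [hD]
    ext i j
    have h3 := Matrix.mul_diagonal (fun _ => Q)
      ((Matrix.diagonal fun _ => Q) * CStarMatrix.ofMatrix.symm ((Φ N).map φ)) i j
    rw [Matrix.diagonal_mul] at h3
    exact h3.symm
  exact h2 ▸ star_left_conjugate_nonneg h1 D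

/-! ### Transfer from the corner to matrices. -/

-- `hleft` and `hreg` are all that is needed of `Q` as the orbit support: it fixes the orbit and
-- kills whatever the orbit kills.
open scoped MatrixOrder in
theorem cornerMap_pow_eq_zero_of_defectOrbit_eq_zero {A : Type*} [CStarAlgebra A] [PartialOrder A]
    [StarOrderedRing A] {Q : A} (hQ : IsStarProjection Q) {T : A →ₗ[ℂ] A}
    (hpos : ∀ x, 0 ≤ x → 0 ≤ T x) (hsub : T 1 ≤ 1) {n : ℕ} (hn : defectOrbit T n = 0)
    (hleft : ∀ k, Q * defectOrbit T k = defectOrbit T k)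
    (hreg : ∀ y, (∀ k, defectOrbit T k * y = 0) → Q * y = 0) {s : ℕ}
    (e : cornerAlgebra Q hQ ≃⋆ₐ[ℂ] Matrix (Fin s) (Fin s) ℂ) :
    cornerMap hQ T ^ s = 0 ∧ defectOrbit T s = 0 := by
  set a : ℕ → A := defectOrbit T with ha
  have hsucc : ∀ k, a (k + 1) = T (a k) := fun k => by
    simp only [ha, defectOrbit, pow_succ', Module.End.mul_apply]
  have ha0 : ∀ k, 0 ≤ a k := by
    intro k
    induction k with
    | zero => exact sub_nonneg.2 hsub
    | succ k ih => exact hsucc k ▸ hpos _ ih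
  have hQs : star Q = Q := hQ.isSelfAdjoint.star_eq
  have hQQ : Q * Q = Q := hQ.isIdempotentElem
  have has : ∀ k, star (a k) = a k := fun k => (IsSelfAdjoint.of_nonneg (ha0 k)).star_eq
  have hright : ∀ k, a k * Q = a k := fun k => by
    simpa [hQs, has] using congrArg star (hleft k)
  have hQaQ : ∀ k, Q * a k * Q = a k := fun k => by rw [hleft, hright]
  let α := cornerMap hQ T
  let b : ℕ → cornerAlgebra Q hQ := fun k => ⟨a k, (mem_cornerAlgebra_iff hQ).2 (hQaQ k)⟩
  have hαb : ∀ k, α (b k) = b (k + 1) := fun k => Subtype.ext <| by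
    change Q * T (a k) * Q = a (k + 1)
    rw [← hsucc, hQaQ]
  have hαpow : ∀ m k, (α ^ m) (b k) = b (m + k) := by
    intro m
    induction m with
    | zero => intro k; simp
    | succ m ih =>
      intro k
      rw [pow_succ, Module.End.mul_apply, hαb, ih, show m + (k + 1) = m + 1 + k by omega]
  have hαpos : ∀ x, 0 ≤ x → 0 ≤ α x := fun x (hx : 0 ≤ (x : A)) => by
    change 0 ≤ Q * T x * Q
    simpa [hQs] using star_left_conjugate_nonneg (hpos _ hx) Q
  have hvanish : ∀ k, n ≤ k → a k = 0 := by
    intro k hk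
    induction k, hk using Nat.le_induction with
    | base => exact hn
    | succ k _ ih => rw [hsucc, ih, map_zero]
  -- The corner is typed as a non-unital algebra, so its unit and `e u = 1` are established by hand.
  let u : cornerAlgebra Q hQ := ⟨Q, (mem_cornerAlgebra_iff hQ).2 (by rw [hQQ, hQQ])⟩
  have hQx : ∀ x : cornerAlgebra Q hQ, Q * (x : A) = x := fun x => by
    conv_lhs => rw [← (mem_cornerAlgebra_iff hQ).1 x.2]
    rw [← mul_assoc, ← mul_assoc, hQQ, (mem_cornerAlgebra_iff hQ).1 x.2]
  have heu : e u = 1 := by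
    have h1 : u * e.symm 1 = e.symm 1 := Subtype.ext (hQx _)
    simpa using congrArg e h1
  have hαu : α u ≤ u := by
    change Q * T Q * Q ≤ Q
    have hQ1 : Q ≤ 1 := hQ.le_one
    have h1 : T Q ≤ 1 := by
      refine le_trans ?_ hsub
      rw [← sub_nonneg, ← map_sub]
      exact hpos _ (sub_nonneg.2 hQ1)
    have h2 := star_left_conjugate_le_conjugate h1 Q
    rwa [hQs, mul_one, hQQ] at h2
  have hepos : ∀ x, 0 ≤ x → 0 ≤ e x := fun x hx => map_nonneg e hx
  have hespos : ∀ x, 0 ≤ x → 0 ≤ e.symm x := fun x hx => map_nonneg e.symm hx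
  let el : cornerAlgebra Q hQ ≃ₗ[ℂ] Matrix (Fin s) (Fin s) ℂ :=
    { e with
      toFun := e
      invFun := e.symm
      map_add' := map_add e
      map_smul' := map_smul e }
  let β : Module.End ℂ (Matrix (Fin s) (Fin s) ℂ) := el.conjAlgEquiv ℂ α
  have hβpow : ∀ k X, (β ^ k) X = e ((α ^ k) (e.symm X)) := fun k X => by
    simp only [β, ← map_pow]
    rfl
  have hβ : ∀ X, β X = e (α (e.symm X)) := fun X => rfl
  have hβs : β ^ s = 0 := by
    refine Matrix.pow_eq_zero_of_nilpotent_positive β (n := n)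
      (A := e (∑ k ∈ Finset.range n, b k)) (fun X hX => ?_) ?_ ?_ (fun N hN => ?_) ?_
    · exact hepos _ (hαpos _ (hespos _ hX))
    · rw [← heu, hβ, StarAlgEquiv.symm_apply_apply, ← sub_nonneg, ← map_sub]
      exact hepos _ (sub_nonneg.2 hαu)
    · exact hepos _ (Finset.sum_nonneg fun k _ => ha0 k)
    · have h0 : (∑ k ∈ Finset.range n, b k) * e.symm N = 0 := by
        have h := congrArg e.symm hN
        rwa [map_mul, StarAlgEquiv.symm_apply_apply, map_zero] at h
      let y : A := ((e.symm N : cornerAlgebra Q hQ) : A)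
      have h1 : (∑ k ∈ Finset.range n, a k) * y = 0 := by
        have h2 := congrArg (fun z : cornerAlgebra Q hQ => (z : A)) h0
        simpa [b] using h2
      -- Conjugation by `y` makes every summand positive, so each one vanishes separately.
      have h2 : ∑ k ∈ Finset.range n, star y * a k * y = 0 := by
        rw [← Finset.sum_mul, ← Finset.mul_sum, mul_assoc, h1, mul_zero]
      have h3 := (Finset.sum_eq_zero_iff_of_nonneg fun k _ =>
        star_left_conjugate_nonneg (ha0 k) y).1 h2
      have h4 : ∀ k, a k * y = 0 := by
        intro k
        rcases lt_or_ge k n with hk | hk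
        · have h5 := h3 k (Finset.mem_range.2 hk)
          obtain ⟨c, hc⟩ := CStarAlgebra.nonneg_iff_eq_star_mul_self.1 (ha0 k)
          rw [hc] at h5 ⊢
          have h6 : star (c * y) * (c * y) = 0 := by
            rw [star_mul, ← h5]
            simp only [mul_assoc]
          rw [mul_assoc, CStarRing.star_mul_self_eq_zero_iff _ |>.1 h6, mul_zero]
        · rw [hvanish k hk, zero_mul]
      have h7 : e.symm N = 0 := Subtype.ext ((hQx _).symm.trans (hreg y h4))
      simpa using congrArg e h7
    · rw [hβpow, StarAlgEquiv.symm_apply_apply, map_sum, Finset.sum_eq_zero, map_zero]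
      intro k _
      rw [hαpow]
      exact Subtype.ext (hvanish _ (Nat.le_add_right n k))
  have hαs : α ^ s = 0 := by
    apply (el.conjAlgEquiv ℂ).injective
    rw [map_pow, map_zero]
    exact hβs
  refine ⟨hαs, ?_⟩
  -- The defect itself lies in the corner, so `α ^ s = 0` kills its `s`-th iterate.
  have h1 := hαpow s 0
  rw [hαs] at h1
  exact congrArg (fun z : cornerAlgebra Q hQ => (z : A)) h1.symm

/-! ### The orbit-support projection. -/

namespace VonNeumannAlgebra

variable {H : Type*} [NormedAddCommGroup H] [InnerProductSpace ℂ H] [CompleteSpace H]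

theorem range_closureProj (M : VonNeumannAlgebra H) (K : Submodule ℂ H)
    (hK : ∀ y ∈ M.commutant, ∀ v ∈ K, y v ∈ K) :
    (M.closureProj K hK : H →L[ℂ] H).range = K.topologicalClosure :=
  Submodule.range_starProjection _

theorem closureProj_mul_eq_self (M : VonNeumannAlgebra H) (K : Submodule ℂ H)
    (hK : ∀ y ∈ M.commutant, ∀ v ∈ K, y v ∈ K) {x : M}
    (hx : ∀ v, (x : H →L[ℂ] H) v ∈ K.topologicalClosure) : M.closureProj K hK * x = x :=
  Subtype.ext <| ContinuousLinearMap.ext fun v =>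
    Submodule.starProjection_eq_self_iff.2 (hx v)

theorem closureProj_mul_eq_zero (M : VonNeumannAlgebra H) (K : Submodule ℂ H)
    (hK : ∀ y ∈ M.commutant, ∀ v ∈ K, y v ∈ K) {x : M}
    (hx : ∀ v, (x : H →L[ℂ] H) v ∈ Kᗮ) : M.closureProj K hK * x = 0 :=
  Subtype.ext <| ContinuousLinearMap.ext fun v => by
    change K.topologicalClosure.starProjection ((x : H →L[ℂ] H) v) = 0
    rw [Submodule.starProjection_apply_eq_zero_iff, Submodule.orthogonal_closure]
    exact hx v

theorem orbitSupport_mul_defectOrbit (M : VonNeumannAlgebra H) (T : M →ₗ[ℂ] M) (k : ℕ) :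
    M.orbitSupport T * defectOrbit T k = defectOrbit T k := by
  refine closureProj_mul_eq_self _ _ (M.iSup_range_invariant _) fun v => Submodule.le_topologicalClosure _ ?_
  refine Submodule.mem_iSup_of_mem k ?_
  rw [supportProj, range_closureProj]
  exact Submodule.le_topologicalClosure _ ⟨v, rfl⟩

/-- The kernel of a self-adjoint operator is orthogonal to its range, so the range of `y` is
orthogonal to every support. -/
theorem orbitSupport_mul_eq_zero (M : VonNeumannAlgebra H) (T : M →ₗ[ℂ] M)
    (hs : ∀ k, IsSelfAdjoint (defectOrbit T k)) {y : M} (hy : ∀ k, defectOrbit T k * y = 0) :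
    M.orbitSupport T * y = 0 := by
  refine closureProj_mul_eq_zero _ _ (M.iSup_range_invariant _) fun v => ?_
  rw [← Submodule.iInf_orthogonal, Submodule.mem_iInf]
  intro k
  rw [supportProj, range_closureProj, Submodule.orthogonal_closure, Submodule.mem_orthogonal]
  rintro _ ⟨w, rfl⟩
  have h1 : ((defectOrbit T k : M) : H →L[ℂ] H) ((y : H →L[ℂ] H) v) = 0 :=
    congrArg (fun z : M => (z : H →L[ℂ] H) v) (hy k)
  have h2 : IsSelfAdjoint ((defectOrbit T k : M) : H →L[ℂ] H) := congrArg Subtype.val (hs k)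
  refine (ContinuousLinearMap.isSelfAdjoint_iff_isSymmetric.1 h2 w _).trans ?_
  change inner ℂ w (((defectOrbit T k : M) : H →L[ℂ] H) ((y : H →L[ℂ] H) v)) = 0
  rw [h1, inner_zero_right]

end VonNeumannAlgebra

theorem mainTheorem10 {H : Type*} [NormedAddCommGroup H] [InnerProductSpace ℂ H]
    [CompleteSpace H] (M : VonNeumannAlgebra H) (T : M →ₗ[ℂ] M)
    (hCP : IsCompletelyPositive T) (hnormal : IsNormalMap T) (hsub : T 1 ≤ 1)
    (hfin : stabilizationIndex T < ⊤)
    (hQ : IsFiniteProjection (M.orbitSupport T)) (s : ℕ) (hs : 1 ≤ s)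
    (hiso : Nonempty (cornerAlgebra (M.orbitSupport T) (M.isStarProjection_orbitSupport T)
      ≃⋆ₐ[ℂ] Matrix (Fin s) (Fin s) ℂ)) :
    stabilizationIndex T ≤ s ∧
      IsCompletelyPositive (cornerMap (M.isStarProjection_orbitSupport T) T) ∧
      (cornerMap (M.isStarProjection_orbitSupport T) T) ^ s = 0 := by
  have hpos : ∀ x, 0 ≤ x → 0 ≤ T x := by
    obtain ⟨φ, rfl⟩ := hCP
    exact fun x hx => map_nonneg φ hx
  obtain ⟨n, hn⟩ : ∃ n, 1 ≤ n ∧ defectOrbit T n = 0 := by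
    by_contra! h
    refine hfin.ne (iInf_eq_top.2 fun n => iInf_eq_top.2 fun hn => ?_)
    exact (h n hn.1 hn.2).elim
  have hself : ∀ k, IsSelfAdjoint (defectOrbit T k) := by
    intro k
    refine IsSelfAdjoint.of_nonneg ?_
    induction k with
    | zero => exact sub_nonneg.2 hsub
    | succ k ih =>
      rw [defectOrbit, pow_succ', Module.End.mul_apply]
      exact hpos _ ih
  obtain ⟨e⟩ := hiso
  obtain ⟨hα, hd⟩ := cornerMap_pow_eq_zero_of_defectOrbit_eq_zero
    (M.isStarProjection_orbitSupport T) hpos hsub hn.2 (M.orbitSupport_mul_defectOrbit T)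
    (fun y hy => M.orbitSupport_mul_eq_zero T hself hy) e
  exact ⟨iInf₂_le s ⟨hs, hd⟩, isCompletelyPositive_cornerMap _ hCP, hα⟩
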